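/- Let $\mathcal A$ be a finite discrete alphabet and let $T$ (also written $S$) be the left shift $(Tx)(j)=x(j+1)$ on $\mathcal A^{\mathbb Z}$. Let $X,Y\subseteq\mathcal A^{\mathbb Z}$ be nonempty $1$-step shifts of finite type, i.e. each is the set of all sequences $x$ with $(x(j),x(j+1))\notin\mathcal F$ for every $j\in\mathbb Z$, for some $\mathcal F\subseteq\mathcal A^{\{0,1\}}$. Assume that $X$ and $Y$ are transitive in the following sense ($X$ is written, $Y$ is analogous): there is $D\in\mathbb N$ such that for all $x_1,x_2\in X$ and all integers $b_1,a_2$ with $a_2-b_1\ge D$ there is $x'\in X$ with $x'(j)=x_1(j)$ for $j\le b_1$ and $x'(j)=x_2(j)$ for $j\ge a_2$. Let $F:\mathcal A^2\to\mathbb R$ and $f(x,y)=F(x(0),y(0))$ for $(x,y)\in X\times Y$. For integers $a\le b$ let $P_{a,b}=\{(x(a),x(b)):x\in X\}$, and for $(v_1,v_2)\in P_{a,b}$ and $y\in Y$ put $$H_{a,b,v_1,v_2}(y)=\min\Big\{\sum_{j=a}^{b}f(T^jx,S^jy):x\in X,\ x(a)=v_1,\ x(b)=v_2\Big\}.$$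 For $C\ge 0$, a point $y'\in Y$ is an $(f,C)$-improvement of $y\in Y$ on $[a,b]$ if $y'(j)=y(j)$ for all $j\in\mathbb Z\setminus[a,b]$ and $H_{a,b,v_1,v_2}(y)+C<H_{a,b,v_1,v_2}(y')$ for all $(v_1,v_2)\in P_{a,b}$. Let $Y_{f,C}$ be the set of all $y\in Y$ that have no $(f,C)$-improvement on any $[a,b]$ with $a\le b$. For a shift-invariant Borel probability measure $\nu$ on $Y$ let $$\psi_f(\nu)=\min\Big\{\int f\,d\lambda:\lambda\text{ a }(T\times S)\text{-invariant Borel probability measure on }X\times Y\text{ whose marginal on }Y\text{ is }\nu\Big\}.$$ Then for every $C\ge 0$ and every $S$-invariant Borel probability measure $\nu_0$ on $Y$ that is supported on $Y_{f,C}$ (that is, $\nu_0(Y\setminus Y_{f,C})=0$), the measure $\nu_0$ is $\alpha$-maximizing for $f$: $\psi_f(\nu)\le\psi_f(\nu_0)$ for every $S$-invariant Borel probability measure $\nu$ on $Y$. -/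

import Mathlib

open MeasureTheory Filter Topology
open SymbolicDynamics.FullShift (Subshift shift)

namespace AdversarialOptimization

section Measures

variable {Z Y : Type*} [MeasurableSpace Z] [MeasurableSpace Y]

/-- The invariant probability measures of a map `U`. -/
def invariantMeasures (U : Z → Z) : Set (ProbabilityMeasure Z) :=
  {μ | MeasurePreserving U (μ : Measure Z) (μ : Measure Z)}

/-- The `U`-invariant probability measures on `Z` whose image under `π` is `ν`. -/
def fiberMeasures (U : Z → Z) (π : Z → Y) (ν : ProbabilityMeasure Y) :
    Set (ProbabilityMeasure Z) :=
  {μ | μ ∈ invariantMeasures U ∧ (μ : Measure Z).map π = (ν : Measure Y)}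

/-- `ψ_f(ν)`, the minimum of `∫ f dλ` over the `U`-invariant probability measures `λ` with
`π_* λ = ν`. It is written as an infimum; `isLeast_psi_subshift` shows
that for subshifts it is an attained minimum. -/
noncomputable def psi (U : Z → Z) (π : Z → Y) (f : Z → ℝ) (ν : ProbabilityMeasure Y) : ℝ :=
  sInf ((fun μ : ProbabilityMeasure Z => ∫ z, f z ∂(μ : Measure Z)) '' fiberMeasures U π ν)

/-- `ν₀` is an `S`-invariant probability measure at which `ψ_f` attains its supremum over the
`S`-invariant probability measures. -/
def IsAlphaMaximizing (U : Z → Z) (S : Y → Y) (π : Z → Y) (f : Z → ℝ)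
    (ν₀ : ProbabilityMeasure Y) : Prop :=
  ν₀ ∈ invariantMeasures S ∧ ∀ ν ∈ invariantMeasures S, psi U π f ν ≤ psi U π f ν₀

end Measures

section Shifts

variable {A : Type*} [TopologicalSpace A]

/-- The `g`-th power of the left shift, restricted to a subshift: `(T^g x)(j) = x(g + j)`. -/
def shiftPow (X : Subshift A ℤ) (g : ℤ) (x : X.carrier) : X.carrier :=
  ⟨shift g x.1, X.mapsTo g x.2⟩

/-- The left shift `T` on a subshift. -/
def shiftMap (X : Subshift A ℤ) : X.carrier → X.carrier := shiftPow X 1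

/-- `X` is an `M`-step shift of finite type: it consists of all sequences none of whose blocks of
length `M + 1` lies in some set `ℱ` of forbidden blocks. -/
def IsStepSFT (M : ℕ) (X : Subshift A ℤ) : Prop :=
  ∃ ℱ : Set (Fin (M + 1) → A),
    X.carrier = {x | ∀ j : ℤ, (fun i : Fin (M + 1) => x (j + (i : ℕ))) ∉ ℱ}

/-- Transitivity with a uniform gap: a left half and a right half of points of `X` can be joined
whenever they are at distance at least `D`. -/
def IsTransitive (X : Subshift A ℤ) : Prop :=
  ∃ D : ℕ, ∀ x₁ ∈ X.carrier, ∀ x₂ ∈ X.carrier, ∀ b₁ a₂ : ℤ, (D : ℤ) ≤ a₂ - b₁ →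
    ∃ x' ∈ X.carrier, (∀ j ≤ b₁, x' j = x₁ j) ∧ ∀ j ≥ a₂, x' j = x₂ j

/-- `P_{a,b}`: the pairs of symbols that occur at the places `a`, `b` of some point of `X`. -/
def endpointPairs (X : Subshift A ℤ) (a b : ℤ) : Set (A × A) :=
  {v | ∃ x ∈ X.carrier, x a = v.1 ∧ x b = v.2}

variable {X Y : Subshift A ℤ}

/-- The ergodic sum of `f` over the integer interval `[a, b]`. -/
noncomputable def ergodicSum (f : X.carrier × Y.carrier → ℝ) (a b : ℤ)
    (x : X.carrier) (y : Y.carrier) : ℝ :=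
  ∑ j ∈ Finset.Icc a b, f (shiftPow X j x, shiftPow Y j y)

/-- `H_{a,b,v₁,v₂}(y)`: the minimum over `x ∈ X` with `x(a) = v₁`, `x(b) = v₂` of the ergodic sum
of `f` over `[a, b]`. For `v ∈ P_{a,b}` it is an attained minimum, see `isLeast_constrainedMin`. -/
noncomputable def constrainedMin (f : X.carrier × Y.carrier → ℝ) (a b : ℤ) (v : A × A)
    (y : Y.carrier) : ℝ :=
  sInf ((fun x => ergodicSum f a b x y) '' {x : X.carrier | x.1 a = v.1 ∧ x.1 b = v.2})

/-- `y'` is an `(f, C)`-improvement of `y` on `[a, b]`. -/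
def IsImprovement (f : X.carrier × Y.carrier → ℝ) (C : ℝ) (a b : ℤ) (y y' : Y.carrier) : Prop :=
  (∀ j : ℤ, j ∉ Set.Icc a b → y.1 j = y'.1 j) ∧
    ∀ v ∈ endpointPairs X a b, constrainedMin f a b v y + C < constrainedMin f a b v y'

/-- `Y_{f,C}`: the points of `Y` that admit no `(f, C)`-improvement on any `[a, b]`. -/
def groundStates (f : X.carrier × Y.carrier → ℝ) (C : ℝ) : Set Y.carrier :=
  {y | ∀ a b : ℤ, a ≤ b → ∀ y' : Y.carrier, ¬ IsImprovement f C a b y y'}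

/-- The set given by `⋂_{a ≤ b} ⋃_v {y : H_v(y) ≥ max_{y'} H_v(y') - C}`, where one pair `v` has to
serve all competitors `y'`, lies in `groundStates f C`. A measure supported on it is therefore
supported on `groundStates f C`. -/
theorem subset_groundStates (f : X.carrier × Y.carrier → ℝ) (C : ℝ) :
    {y : Y.carrier | ∀ a b : ℤ, a ≤ b → ∃ v ∈ endpointPairs X a b, ∀ y' : Y.carrier,
      (∀ j : ℤ, j ∉ Set.Icc a b → y'.1 j = y.1 j) →
        constrainedMin f a b v y' - C ≤ constrainedMin f a b v y} ⊆ groundStates f C := by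
  intro y hy a b hab y' h
  obtain ⟨v, hv, hmax⟩ := hy a b hab
  have h1 := hmax y' fun j hj => (h.1 j hj).symm
  have h2 := h.2 v hv
  linarith

theorem continuous_shiftPow (X : Subshift A ℤ) (g : ℤ) : Continuous (shiftPow X g) :=
  ((SymbolicDynamics.FullShift.continuous_shift g).comp continuous_subtype_val).subtype_mk _

theorem isLeast_constrainedMin [Finite A] [DiscreteTopology A] (f : C(X.carrier × Y.carrier, ℝ))
    (a b : ℤ) (v : A × A) (hv : v ∈ endpointPairs X a b) (y : Y.carrier) :
    IsLeast ((fun x => ergodicSum f a b x y) '' {x : X.carrier | x.1 a = v.1 ∧ x.1 b = v.2})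
      (constrainedMin f a b v y) := by
  have : CompactSpace X.carrier := isCompact_iff_compactSpace.mp X.isClosed.isCompact
  have hcl : IsClosed {x : X.carrier | x.1 a = v.1 ∧ x.1 b = v.2} :=
    (isClosed_eq ((continuous_apply a).comp continuous_subtype_val) continuous_const).inter
      (isClosed_eq ((continuous_apply b).comp continuous_subtype_val) continuous_const)
  have hcont : Continuous fun x : X.carrier => ergodicSum f a b x y :=
    continuous_finsetSum _ fun j _ =>
      f.continuous.comp ((continuous_shiftPow X j).prodMk continuous_const)
  obtain ⟨x, hx, h⟩ := hv
  exact (hcl.isCompact.image hcont).isLeast_sInf ⟨_, ⟨x, hx⟩, h, rfl⟩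

end Shifts

section Minimum

/-- `ψ_f(ν)` is an attained minimum as soon as some invariant measure lies over `ν`. -/
theorem isLeast_psi {Z Y : Type*} [TopologicalSpace Z] [CompactSpace Z] [T2Space Z]
    [TopologicalSpace.PseudoMetrizableSpace Z]
    [MeasurableSpace Z] [BorelSpace Z] [TopologicalSpace Y] [T2Space Y]
    [TopologicalSpace.PseudoMetrizableSpace Y] [MeasurableSpace Y] [BorelSpace Y]
    {U : Z → Z} (hU : Continuous U) {π : Z → Y} (hπ : Continuous π) (f : C(Z, ℝ))
    (ν : ProbabilityMeasure Y) (hne : (fiberMeasures U π ν).Nonempty) :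
    IsLeast ((fun μ : ProbabilityMeasure Z => ∫ z, f z ∂(μ : Measure Z)) '' fiberMeasures U π ν)
      (psi U π f ν) := by
  have hfib : fiberMeasures U π ν =
      {μ | μ.map hU.measurable.aemeasurable = μ} ∩ {μ | μ.map hπ.measurable.aemeasurable = ν} := by
    ext μ
    simp only [fiberMeasures, invariantMeasures, Set.mem_ofPred_eq, Set.mem_inter_iff]
    refine and_congr ⟨fun h => Subtype.ext h.map_eq, fun h => ⟨hU.measurable, ?_⟩⟩
      ⟨fun h => Subtype.ext h, fun h => ?_⟩
    · exact congrArg Subtype.val h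
    · exact congrArg Subtype.val h
  have hcl : IsClosed (fiberMeasures U π ν) := by
    rw [hfib]
    exact (isClosed_eq (ProbabilityMeasure.continuous_map hU) continuous_id).inter
      (isClosed_eq (ProbabilityMeasure.continuous_map hπ) continuous_const)
  have hcont : Continuous fun μ : ProbabilityMeasure Z => ∫ z, f z ∂(μ : Measure Z) :=
    ProbabilityMeasure.continuous_integral_boundedContinuousFunction
      (BoundedContinuousFunction.mkOfCompact f)
  exact (hcl.isCompact.image hcont).isLeast_sInf (hne.image _)

/-- A continuous self-map of a nonempty compact metrizable space has an invariant measure. -/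
theorem invariantMeasures_nonempty {Z : Type*} [TopologicalSpace Z] [CompactSpace Z] [T2Space Z]
    [TopologicalSpace.PseudoMetrizableSpace Z] [MeasurableSpace Z] [BorelSpace Z] [Nonempty Z]
    {T : Z → Z} (hT : Continuous T) : (invariantMeasures T).Nonempty := by
  obtain ⟨x⟩ := ‹Nonempty Z›
  let m : ℕ → Measure Z := fun n =>
    ((n + 1 : ℕ) : ENNReal)⁻¹ • ∑ i ∈ Finset.range (n + 1), Measure.dirac (T^[i] x)
  have hm : ∀ n, IsProbabilityMeasure (m n) := fun n => ⟨by
    simp only [m, Measure.smul_apply, Measure.coe_finsetSum, Finset.sum_apply, measure_univ,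
      Finset.sum_const, Finset.card_range, smul_eq_mul, nsmul_eq_mul, mul_one]
    exact ENNReal.inv_mul_cancel (by simp) (by simp)⟩
  let p : ℕ → ProbabilityMeasure Z := fun n => ⟨m n, hm n⟩
  let 𝒰 : Ultrafilter (ProbabilityMeasure Z) := (hyperfilter ℕ).map p
  obtain ⟨μ, -, hμ⟩ := isCompact_univ.ultrafilter_le_nhds 𝒰 (by simp)
  have hlim : Tendsto p (hyperfilter ℕ : Filter ℕ) (𝓝 μ) := hμ
  have hint : ∀ (g : BoundedContinuousFunction Z ℝ) n,
      ∫ z, g z ∂(m n) = ((n + 1 : ℕ) : ℝ)⁻¹ * ∑ i ∈ Finset.range (n + 1), g (T^[i] x) := by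
    intro g n
    simp only [m]
    rw [integral_smul_measure, integral_finsetSum_measure fun i _ => g.integrable _,
      ENNReal.toReal_inv, ENNReal.toReal_natCast, smul_eq_mul]
    simp
  refine ⟨μ, hT.measurable, ?_⟩
  have hprob : IsProbabilityMeasure ((μ : Measure Z).map T) :=
    Measure.isProbabilityMeasure_map hT.measurable.aemeasurable
  refine ext_of_forall_integral_eq_of_IsFiniteMeasure fun g => ?_
  rw [integral_map hT.measurable.aemeasurable g.continuous.aestronglyMeasurable]
  let gT : BoundedContinuousFunction Z ℝ := g.compContinuous ⟨T, hT⟩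
  have l1 : Tendsto (fun n => ∫ z, g z ∂(m n)) (hyperfilter ℕ : Filter ℕ)
      (𝓝 (∫ z, g z ∂(μ : Measure Z))) :=
    ((ProbabilityMeasure.continuous_integral_boundedContinuousFunction g).tendsto μ).comp hlim
  have l2 : Tendsto (fun n => ∫ z, gT z ∂(m n)) (hyperfilter ℕ : Filter ℕ)
      (𝓝 (∫ z, gT z ∂(μ : Measure Z))) :=
    ((ProbabilityMeasure.continuous_integral_boundedContinuousFunction gT).tendsto μ).comp hlim
  have l3 : Tendsto (fun n => ∫ z, gT z ∂(m n) - ∫ z, g z ∂(m n)) (hyperfilter ℕ : Filter ℕ)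
      (𝓝 0) := by
    have hle : (hyperfilter ℕ : Filter ℕ) ≤ atTop := by
      rw [← Nat.cofinite_eq_atTop]
      exact hyperfilter_le_cofinite
    refine Tendsto.mono_left ?_ hle
    have hz : Tendsto (fun n : ℕ => (2 * ‖g‖) * (1 / ((n : ℝ) + 1))) atTop (𝓝 0) := by
      simpa using tendsto_one_div_add_atTop_nhds_zero_nat.const_mul (2 * ‖g‖)
    refine squeeze_zero_norm (fun n => ?_) hz
    have key : ∑ i ∈ Finset.range (n + 1), gT (T^[i] x) - ∑ i ∈ Finset.range (n + 1), g (T^[i] x)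
        = g (T^[n + 1] x) - g x := by
      rw [← Finset.sum_sub_distrib]
      have := Finset.sum_range_sub (fun i => g (T^[i] x)) (n + 1)
      simpa [gT, Function.iterate_succ_apply'] using this
    rw [hint, hint, ← mul_sub, key, norm_mul, mul_comm]
    have h2 : ‖g (T^[n + 1] x) - g x‖ ≤ 2 * ‖g‖ :=
      (norm_sub_le _ _).trans (by linarith [g.norm_coe_le_norm (T^[n + 1] x), g.norm_coe_le_norm x])
    have h3 : ‖(((n + 1 : ℕ) : ℝ))⁻¹‖ = 1 / ((n : ℝ) + 1) := by
      rw [norm_inv, Real.norm_of_nonneg (by positivity)]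
      push_cast
      rw [one_div]
    rw [h3]
    gcongr
  have := tendsto_nhds_unique (l2.sub l1) l3
  exact sub_eq_zero.mp this

/-- In a product system, some invariant measure lies over each invariant measure of the second
factor. -/
theorem fiberMeasures_snd_nonempty {X Y : Type*} [TopologicalSpace X] [CompactSpace X] [T2Space X]
    [TopologicalSpace.PseudoMetrizableSpace X] [MeasurableSpace X] [BorelSpace X] [Nonempty X]
    [MeasurableSpace Y] {T : X → X} (hT : Continuous T) {S : Y → Y} (ν : ProbabilityMeasure Y)
    (hν : ν ∈ invariantMeasures S) : (fiberMeasures (Prod.map T S) Prod.snd ν).Nonempty := by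
  obtain ⟨μ, hμ⟩ := invariantMeasures_nonempty hT
  refine ⟨μ.prod ν, ?_, ?_⟩
  · have h : MeasurePreserving (Prod.map T S) ((μ : Measure X).prod (ν : Measure Y))
        ((μ : Measure X).prod (ν : Measure Y)) := MeasurePreserving.prod hμ hν
    exact h
  · have h : ((μ : Measure X).prod (ν : Measure Y)).map Prod.snd = (ν : Measure Y) := by simp
    exact h

/-- For subshifts over a finite alphabet, `ψ_f(ν)` is an attained minimum. -/
theorem isLeast_psi_subshift {A : Type*} [Finite A] [TopologicalSpace A] [DiscreteTopology A]
    [MeasurableSpace A] [BorelSpace A] (X Y : Subshift A ℤ) (hX : X.carrier.Nonempty)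
    (f : C(X.carrier × Y.carrier, ℝ)) (ν : ProbabilityMeasure Y.carrier)
    (hν : ν ∈ invariantMeasures (shiftMap Y)) :
    IsLeast ((fun μ : ProbabilityMeasure (X.carrier × Y.carrier) =>
        ∫ z, f z ∂(μ : Measure (X.carrier × Y.carrier))) ''
          fiberMeasures (Prod.map (shiftMap X) (shiftMap Y)) Prod.snd ν)
      (psi (Prod.map (shiftMap X) (shiftMap Y)) Prod.snd f ν) := by
  have : CompactSpace X.carrier := isCompact_iff_compactSpace.mp X.isClosed.isCompact
  have : CompactSpace Y.carrier := isCompact_iff_compactSpace.mp Y.isClosed.isCompact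
  have : Nonempty X.carrier := hX.to_subtype
  exact isLeast_psi ((continuous_shiftPow X 1).prodMap (continuous_shiftPow Y 1)) continuous_snd f
    ν (fiberMeasures_snd_nonempty (continuous_shiftPow X 1) ν hν)

end Minimum

end AdversarialOptimization

open AdversarialOptimization

/-! ### Invariant measures over a prescribed factor measure. -/

namespace AdversarialOptimization

/-! Suppose $\psi_f(\nu_0)<c<\psi_f(\nu)$. Both inequalities pass to finite words, where no
ergodicity and no pointwise ergodic theorem is needed. If, for all large $n$, every $y\in Y$ had an
$x$ with sum at most $nc$ over $[0,n-1]$, such $x$ could be chosen continuously in $y$. Averaging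
the resulting graph measures over $\nu$ would give an invariant measure over $\nu$ with integral at
most $c<\psi_f(\nu)$. So for arbitrarily large $n$ some $w\in Y$ has all its sums above $nc$
(`frequently_exists_forall_lt_sum`). An optimal measure over $\nu_0$ yields, for each $n$, a $y\in
Y_{f,C}$ and an $x$ with sum at most $n\psi_f(\nu_0)$ (`exists_sum_le_mul_psi`). By transitivity the
word of $w$ can be inserted into $y$. The gluing gaps and the endpoint constraints cost a constant
$K$ independent of $n$, so once $n(c-\psi_f(\nu_0))>K+C$ this is an improvement of $y$, a
contradiction (`exists_improvement`). -/

/-- Krylov–Bogoliubov over a factor: if the ergodic averages of `f` are asymptotically at most `c`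
in the mean along measures over `ν`, then some invariant measure over `ν` integrates `f` to at
most `c`. -/
theorem exists_mem_fiberMeasures_integral_le {Z Y : Type*}
    [TopologicalSpace Z] [CompactSpace Z] [T2Space Z]
    [TopologicalSpace.PseudoMetrizableSpace Z] [MeasurableSpace Z] [BorelSpace Z]
    [TopologicalSpace Y] [TopologicalSpace.PseudoMetrizableSpace Y]
    [MeasurableSpace Y] [BorelSpace Y]
    {U : Z → Z} (hU : Continuous U) {S : Y → Y} {π : Z → Y} (hπ : Continuous π)
    (hsc : Function.Semiconj π U S) (f : C(Z, ℝ)) {ν : ProbabilityMeasure Y}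
    (hν : ν ∈ invariantMeasures S) (σ : ℕ → ProbabilityMeasure Z)
    (hσ : ∀ n, (σ n : Measure Z).map π = (ν : Measure Y)) {c : ℝ}
    (hc : ∀ᶠ n : ℕ in atTop, ∀ᵐ z ∂(σ n : Measure Z),
      ∑ i ∈ Finset.range (n + 1), f (U^[i] z) ≤ ((n + 1 : ℕ) : ℝ) * c) :
    ∃ μ ∈ fiberMeasures U π ν, ∫ z, f z ∂(μ : Measure Z) ≤ c := by
  have hUi : ∀ i, Continuous U^[i] := fun i => hU.iterate i
  let m : ℕ → Measure Z := fun n =>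
    ((n + 1 : ℕ) : ENNReal)⁻¹ • ∑ i ∈ Finset.range (n + 1), (σ n : Measure Z).map U^[i]
  have hm : ∀ n, IsProbabilityMeasure (m n) := fun n => ⟨by
    have h : ∀ i, ((σ n : Measure Z).map U^[i]) Set.univ = 1 := fun i => by
      rw [Measure.map_apply (hUi i).measurable MeasurableSet.univ]; simp
    simp only [m, Measure.smul_apply, Measure.coe_finsetSum, Finset.sum_apply, h,
      Finset.sum_const, Finset.card_range, smul_eq_mul, nsmul_eq_mul, mul_one]
    exact ENNReal.inv_mul_cancel (by simp) (by simp)⟩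
  let p : ℕ → ProbabilityMeasure Z := fun n => ⟨m n, hm n⟩
  -- Convergence along an ultrafilter replaces the choice of a convergent subsequence.
  let 𝒰 : Ultrafilter (ProbabilityMeasure Z) := (hyperfilter ℕ).map p
  obtain ⟨μ, -, hμ⟩ := isCompact_univ.ultrafilter_le_nhds 𝒰 (by simp)
  have hlim : Tendsto p (hyperfilter ℕ : Filter ℕ) (𝓝 μ) := hμ
  have hle : (hyperfilter ℕ : Filter ℕ) ≤ atTop := by
    rw [← Nat.cofinite_eq_atTop]
    exact hyperfilter_le_cofinite
  have hlimit : ∀ g : C(Z, ℝ), Tendsto (fun n => ∫ z, g z ∂(m n)) (hyperfilter ℕ : Filter ℕ)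
      (𝓝 (∫ z, g z ∂(μ : Measure Z))) := fun g =>
    ((ProbabilityMeasure.continuous_integral_boundedContinuousFunction
      (BoundedContinuousFunction.mkOfCompact g)).tendsto μ).comp hlim
  have hintg : ∀ (g : C(Z, ℝ)) (κ : Measure Z) [IsFiniteMeasure κ], Integrable g κ :=
    fun g κ _ => (BoundedContinuousFunction.mkOfCompact g).integrable κ
  have hint : ∀ (g : C(Z, ℝ)) n, ∫ z, g z ∂(m n) =
      ((n + 1 : ℕ) : ℝ)⁻¹ * ∑ i ∈ Finset.range (n + 1), ∫ z, g (U^[i] z) ∂(σ n : Measure Z) := by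
    intro g n
    simp only [m]
    rw [integral_smul_measure, integral_finsetSum_measure fun i _ => hintg g _,
      ENNReal.toReal_inv, ENNReal.toReal_natCast, smul_eq_mul]
    congr 1
    exact Finset.sum_congr rfl fun i _ =>
      integral_map (hUi i).measurable.aemeasurable g.continuous.aestronglyMeasurable
  have hcomp : ∀ (g : C(Z, ℝ)) (i n : ℕ), Integrable (fun z => g (U^[i] z)) (σ n : Measure Z) :=
    fun g i n => hintg (g.comp ⟨U^[i], hUi i⟩) _
  refine ⟨μ, ⟨⟨hU.measurable, ?_⟩, ?_⟩, ?_⟩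
  · have hprob : IsProbabilityMeasure ((μ : Measure Z).map U) :=
      Measure.isProbabilityMeasure_map hU.measurable.aemeasurable
    refine ext_of_forall_integral_eq_of_IsFiniteMeasure fun g => ?_
    rw [integral_map hU.measurable.aemeasurable g.continuous.aestronglyMeasurable]
    let g' : C(Z, ℝ) := g.toContinuousMap
    let gU : C(Z, ℝ) := g'.comp ⟨U, hU⟩
    have l3 : Tendsto (fun n => ∫ z, gU z ∂(m n) - ∫ z, g' z ∂(m n)) (hyperfilter ℕ : Filter ℕ)
        (𝓝 0) := by
      refine Tendsto.mono_left ?_ hle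
      have hz : Tendsto (fun n : ℕ => (2 * ‖g‖) * (1 / ((n : ℝ) + 1))) atTop (𝓝 0) := by
        simpa using tendsto_one_div_add_atTop_nhds_zero_nat.const_mul (2 * ‖g‖)
      refine squeeze_zero_norm (fun n => ?_) hz
      -- For fixed `n` the sum telescopes, and its two boundary terms are bounded by the total mass
      -- alone, so `σ n` may vary freely with `n`.
      have key : ∑ i ∈ Finset.range (n + 1), ∫ z, gU (U^[i] z) ∂(σ n : Measure Z) -
          ∑ i ∈ Finset.range (n + 1), ∫ z, g' (U^[i] z) ∂(σ n : Measure Z)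
          = ∫ z, g' (U^[n + 1] z) ∂(σ n : Measure Z) - ∫ z, g' z ∂(σ n : Measure Z) := by
        rw [← Finset.sum_sub_distrib]
        have := Finset.sum_range_sub (fun i => ∫ z, g' (U^[i] z) ∂(σ n : Measure Z)) (n + 1)
        simp only [Function.iterate_succ_apply', Function.iterate_zero, id_eq] at this ⊢
        exact this
      have hb : ∀ i, ‖∫ z, g' (U^[i] z) ∂(σ n : Measure Z)‖ ≤ ‖g‖ := fun i => by
        refine (norm_integral_le_of_norm_le_const (C := ‖g‖)
          (Eventually.of_forall fun z => g.norm_coe_le_norm (U^[i] z))).trans_eq (by simp)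
      rw [hint, hint, ← mul_sub, key, norm_mul, mul_comm]
      have h2 : ‖∫ z, g' (U^[n + 1] z) ∂(σ n : Measure Z) - ∫ z, g' z ∂(σ n : Measure Z)‖
          ≤ 2 * ‖g‖ := (norm_sub_le _ _).trans (by
            have h0 := hb 0
            simp only [Function.iterate_zero, id_eq] at h0
            linarith [hb (n + 1)])
      have h3 : ‖(((n + 1 : ℕ) : ℝ))⁻¹‖ = 1 / ((n : ℝ) + 1) := by
        rw [norm_inv, Real.norm_of_nonneg (by positivity)]
        push_cast
        rw [one_div]
      rw [h3]
      gcongr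
    exact sub_eq_zero.mp (tendsto_nhds_unique ((hlimit gU).sub (hlimit g')) l3)
  · have hprob : IsProbabilityMeasure ((μ : Measure Z).map π) :=
      Measure.isProbabilityMeasure_map hπ.measurable.aemeasurable
    refine ext_of_forall_integral_eq_of_IsFiniteMeasure fun g => ?_
    rw [integral_map hπ.measurable.aemeasurable g.continuous.aestronglyMeasurable]
    let gπ : C(Z, ℝ) := g.toContinuousMap.comp ⟨π, hπ⟩
    -- Each average already lies exactly over `ν`, by the invariance of `ν`, so the sequence of
    -- integrals is constant.
    refine tendsto_nhds_unique (hlimit gπ) (tendsto_const_nhds.congr fun n => ?_)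
    have h : ∀ i, ∫ z, gπ (U^[i] z) ∂(σ n : Measure Z) = ∫ y, g y ∂(ν : Measure Y) := fun i => by
      have hi : MeasurePreserving S^[i] (ν : Measure Y) (ν : Measure Y) :=
        MeasurePreserving.iterate hν i
      have hmap : (σ n : Measure Z).map (π ∘ U^[i]) = (ν : Measure Y) := by
        rw [(hsc.iterate_right i).comp_eq, ← Measure.map_map hi.measurable hπ.measurable, hσ,
          hi.map_eq]
      rw [← hmap, integral_map (hπ.comp (hUi i)).measurable.aemeasurable
        g.continuous.aestronglyMeasurable]
      rfl
    rw [hint]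
    simp only [h, Finset.sum_const, Finset.card_range, nsmul_eq_mul]
    rw [inv_mul_cancel_left₀ (by positivity)]
  · refine le_of_tendsto (hlimit f) ((hc.filter_mono hle).mono fun n hn => ?_)
    rw [hint, inv_mul_le_iff₀ (by positivity), ← integral_finsetSum _ fun i _ => hcomp f i n]
    refine (integral_mono_ae (integrable_finsetSum _ fun i _ => hcomp f i n)
      (integrable_const _) hn).trans_eq (by simp)

/-! ### Gluing of words and construction of improvements. -/

section Shifts

variable {A : Type*} [TopologicalSpace A]

theorem iterate_shiftMap (X : Subshift A ℤ) (n : ℕ) : (shiftMap X)^[n] = shiftPow X n := by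
  induction n with
  | zero =>
    funext x
    refine Subtype.ext (funext fun j => ?_)
    simp [shiftPow]
  | succ n ih =>
    funext x
    rw [Function.iterate_succ_apply', ih]
    refine Subtype.ext (funext fun j => ?_)
    simp [shiftMap, shiftPow, SymbolicDynamics.FullShift.shift]
    ring_nf

variable {X Y : Subshift A ℤ}

theorem apply_shiftPow {f : X.carrier × Y.carrier → ℝ} {F : A × A → ℝ}
    (hf : ∀ (x : X.carrier) (y : Y.carrier), f (x, y) = F (x.1 0, y.1 0))
    (j : ℤ) (x : X.carrier) (y : Y.carrier) :
    f (shiftPow X j x, shiftPow Y j y) = F (x.1 j, y.1 j) := by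
  rw [hf]
  simp [shiftPow, SymbolicDynamics.FullShift.shift]

theorem apply_iterate_shiftMap {f : X.carrier × Y.carrier → ℝ} {F : A × A → ℝ}
    (hf : ∀ (x : X.carrier) (y : Y.carrier), f (x, y) = F (x.1 0, y.1 0))
    (i : ℕ) (z : X.carrier × Y.carrier) :
    f ((Prod.map (shiftMap X) (shiftMap Y))^[i] z) = F (z.1.1 i, z.2.1 i) := by
  rw [Prod.map_iterate, iterate_shiftMap, iterate_shiftMap]
  exact apply_shiftPow hf i z.1 z.2

/-- The middle part of a point of a transitive subshift can be put into any other point. -/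
theorem IsTransitive.exists_insert (hX : IsTransitive X) :
    ∃ D₀ : ℕ, ∀ D : ℕ, D₀ ≤ D → ∀ x₁ ∈ X.carrier, ∀ x₂ ∈ X.carrier, ∀ n : ℕ,
      ∃ x' ∈ X.carrier, (∀ j ≤ -(D : ℤ), x' j = x₁ j) ∧
        (∀ j ∈ Set.Ico (0 : ℤ) n, x' j = x₂ j) ∧ ∀ j ≥ (n : ℤ) + D, x' j = x₁ j := by
  obtain ⟨D₀, h⟩ := hX
  -- The extra 1 matters for `n = 0`: the second gluing keeps only the places up to `n - 1`, which
  -- must include `-D`.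
  refine ⟨D₀ + 1, fun D hD x₁ h₁ x₂ h₂ n => ?_⟩
  obtain ⟨u, hu, hu1, hu2⟩ := h x₁ h₁ x₂ h₂ (-(D : ℤ)) 0 (by lia)
  obtain ⟨w, hw, hw1, hw2⟩ := h u hu x₁ h₁ (n - 1) (n + D) (by lia)
  refine ⟨w, hw, fun j hj => ?_, fun j hj => ?_, hw2⟩
  · rw [hw1 j (by lia), hu1 j hj]
  · rw [hw1 j (by have := hj.2; lia), hu2 j hj.1]

/-- The ergodic sum over `[-D, n + D]` differs from the one over `[0, n - 1]` by a bounded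
amount. -/
theorem abs_sum_Icc_sub_sum_range_le {M : ℝ} {φ : ℤ → ℝ} (hφ : ∀ j, |φ j| ≤ M) (n D : ℕ) :
    |∑ j ∈ Finset.Icc (-(D : ℤ)) (n + D), φ j - ∑ i ∈ Finset.range n, φ i| ≤ (2 * D + 1) * M := by
  have hrange : ∑ i ∈ Finset.range n, φ i = ∑ j ∈ Finset.Ico (0 : ℤ) n, φ j := by
    refine Finset.sum_bij (fun i _ => (i : ℤ)) ?_ ?_ ?_ ?_
    · intro i hi; simpa using hi
    · intro i _ j _ h; exact_mod_cast h
    · intro j hj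
      rw [Finset.mem_Ico] at hj
      exact ⟨j.toNat, by simp; lia, by lia⟩
    · intros; rfl
  have hsub : Finset.Ico (0 : ℤ) n ⊆ Finset.Icc (-(D : ℤ)) (n + D) := fun j hj => by
    rw [Finset.mem_Ico] at hj
    rw [Finset.mem_Icc]
    lia
  rw [hrange, ← Finset.sum_sdiff hsub, add_sub_cancel_right]
  refine (Finset.abs_sum_le_sum_abs _ _).trans
    ((Finset.sum_le_card_nsmul _ _ M fun j _ => hφ j).trans_eq ?_)
  rw [Finset.card_sdiff_of_subset hsub, Int.card_Icc, Int.card_Ico, nsmul_eq_mul]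
  have : ((n + D + 1 - -(D : ℤ)).toNat - ((n : ℤ) - 0).toNat) = 2 * D + 1 := by lia
  rw [this]
  push_cast
  ring

/-- If a point has, on a long window, a much lower minimal sum than another one, then it admits an
improvement. -/
theorem exists_improvement [Finite A] [DiscreteTopology A] (hXtr : IsTransitive X)
    (hYtr : IsTransitive Y) (f : C(X.carrier × Y.carrier, ℝ)) {F : A × A → ℝ}
    (hf : ∀ (x : X.carrier) (y : Y.carrier), f (x, y) = F (x.1 0, y.1 0)) :
    ∃ K : ℝ, ∀ (C : ℝ) (n : ℕ) (x : X.carrier) (y w : Y.carrier),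
      (∀ u : X.carrier, ∑ i ∈ Finset.range n, F (x.1 i, y.1 i) + K + C <
        ∑ i ∈ Finset.range n, F (u.1 i, w.1 i)) → y ∉ groundStates f C := by
  obtain ⟨DX, hDX⟩ := hXtr.exists_insert
  obtain ⟨DY, hDY⟩ := hYtr.exists_insert
  obtain ⟨D, hD1, hD2⟩ : ∃ D, DX ≤ D ∧ DY ≤ D := ⟨max DX DY, le_max_left _ _, le_max_right _ _⟩
  obtain ⟨M, hM⟩ : ∃ M, ∀ v, |F v| ≤ M := by
    obtain ⟨M, hM⟩ := (Set.finite_range fun v => |F v|).bddAbove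
    exact ⟨M, fun v => hM ⟨v, rfl⟩⟩
  -- The error of the two gaps enters twice: in the upper bound for `y` and in the lower bound for
  -- `y'`.
  refine ⟨2 * ((2 * D + 1) * M), fun C n x y w h hy => ?_⟩
  obtain ⟨y', hy', hl, hmid, hr⟩ := hDY D hD2 y.1 y.2 w.1 w.2 n
  refine hy (-(D : ℤ)) (n + D) (by lia) ⟨y', hy'⟩ ⟨fun j hj => ?_, fun v hv => ?_⟩
  · rcases lt_or_ge j (-(D : ℤ)) with h1 | h1
    · exact (hl j h1.le).symm
    · exact (hr j (not_lt.mp fun h2 => hj ⟨h1, h2.le⟩)).symm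
  · have hsum : ∀ (u : X.carrier) (z : Y.carrier), ergodicSum f (-(D : ℤ)) (n + D) u z =
        ∑ j ∈ Finset.Icc (-(D : ℤ)) (n + D), F (u.1 j, z.1 j) := fun u z =>
      Finset.sum_congr rfl fun j _ => apply_shiftPow hf j u z
    have hbd : ∀ (u : X.carrier) (z : Y.carrier), |ergodicSum f (-(D : ℤ)) (n + D) u z -
        ∑ i ∈ Finset.range n, F (u.1 i, z.1 i)| ≤ (2 * D + 1) * M := fun u z => by
      rw [hsum]
      exact abs_sum_Icc_sub_sum_range_le (fun j => hM (u.1 j, z.1 j)) n D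
    -- Inserting the word of `x` into a point with endpoints `v` makes the good sum available for
    -- every `v` at bounded cost.
    obtain ⟨xv, hxv, hv1, hv2⟩ := id hv
    obtain ⟨x', hx', hxl, hxmid, hxr⟩ := hDX D hD1 xv hxv x.1 x.2 n
    have hup : constrainedMin f (-(D : ℤ)) (n + D) v y ≤
        ∑ i ∈ Finset.range n, F (x.1 i, y.1 i) + (2 * D + 1) * M := by
      refine ((isLeast_constrainedMin f _ _ v hv y).2 ⟨⟨x', hx'⟩,
        ⟨(hxl _ le_rfl).trans hv1, (hxr _ le_rfl).trans hv2⟩, rfl⟩).trans ?_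
      have h1 := (abs_le.mp (hbd ⟨x', hx'⟩ y)).2
      have h2 : ∑ i ∈ Finset.range n, F (x' i, y.1 i) =
          ∑ i ∈ Finset.range n, F (x.1 i, y.1 i) := Finset.sum_congr rfl fun i hi => by
        rw [hxmid i ⟨by lia, by simpa using hi⟩]
      simp only [h2] at h1
      linarith
    -- On the side of `y'` no gluing in `X` is needed, since `h` bounds the sums of all `u`.
    obtain ⟨u, -, hu⟩ := (isLeast_constrainedMin f _ _ v hv ⟨y', hy'⟩).1
    have h1 := (abs_le.mp (hbd u ⟨y', hy'⟩)).1
    have h2 : ∑ i ∈ Finset.range n, F (u.1 i, y' i) =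
        ∑ i ∈ Finset.range n, F (u.1 i, w.1 i) := Finset.sum_congr rfl fun i hi => by
      rw [hmid i ⟨by lia, by simpa using hi⟩]
    simp only [h2] at h1
    have h3 := h u
    simp only at hu
    rw [← hu]
    linarith

/-! ### From `ψ_f` to sums over finite windows. -/

/-- A choice of `x` for every `y` that only concerns the coordinates in `[0, n - 1]` can be made
continuously. -/
theorem exists_continuous_selection [Finite A] [DiscreteTopology A] (n : ℕ)
    {p : X.carrier → (Fin n → A) → Prop}
    (h : ∀ y : Y.carrier, ∃ x, p x fun i => y.1 (i : ℕ)) :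
    ∃ g : Y.carrier → X.carrier, Continuous g ∧ ∀ y, p (g y) fun i => y.1 (i : ℕ) := by
  rcases isEmpty_or_nonempty Y.carrier with hY | hY
  · exact ⟨fun y => isEmptyElim y, continuous_of_discreteTopology, fun y => isEmptyElim y⟩
  choose g hg using h
  let w : Y.carrier → Fin n → A := fun y i => y.1 (i : ℕ)
  have hw : Continuous w :=
    continuous_pi fun i => (continuous_apply _).comp continuous_subtype_val
  -- One representative `y` is fixed per word, so the choice factors through a finite discrete
  -- space.
  refine ⟨fun y => g (Function.invFun w (w y)),
    (continuous_of_discreteTopology (f := fun a => g (Function.invFun w a))).comp hw, fun y => ?_⟩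
  have h1 : w (Function.invFun w (w y)) = w y := Function.invFun_eq ⟨y, rfl⟩
  have h2 : p (g (Function.invFun w (w y))) (w (Function.invFun w (w y))) := hg _
  rwa [h1] at h2

variable [Finite A] [DiscreteTopology A] [MeasurableSpace A] [BorelSpace A]

/-- For `c < ψ_f(ν)` there are arbitrarily long windows on which all sums over some `y` exceed
`c` on average. -/
theorem frequently_exists_forall_lt_sum (hX : X.carrier.Nonempty)
    (f : C(X.carrier × Y.carrier, ℝ)) {F : A × A → ℝ}
    (hf : ∀ (x : X.carrier) (y : Y.carrier), f (x, y) = F (x.1 0, y.1 0))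
    {ν : ProbabilityMeasure Y.carrier} (hν : ν ∈ invariantMeasures (shiftMap Y)) {c : ℝ}
    (hc : c < psi (Prod.map (shiftMap X) (shiftMap Y)) Prod.snd f ν) :
    ∃ᶠ n : ℕ in atTop, ∃ y : Y.carrier, ∀ x : X.carrier,
      ((n + 1 : ℕ) : ℝ) * c < ∑ i ∈ Finset.range (n + 1), F (x.1 i, y.1 i) := by
  have : CompactSpace X.carrier := isCompact_iff_compactSpace.mp X.isClosed.isCompact
  have : CompactSpace Y.carrier := isCompact_iff_compactSpace.mp Y.isClosed.isCompact
  have : Nonempty X.carrier := hX.to_subtype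
  intro hev
  -- The bound is available only for large `n`, but `g` is needed for all `n`; hence the condition
  -- on `n` is kept as a premise inside `p`.
  have hsel : ∀ n : ℕ, ∃ g : Y.carrier → X.carrier, Continuous g ∧ ∀ y : Y.carrier,
      (¬∃ y : Y.carrier, ∀ x : X.carrier,
        ((n + 1 : ℕ) : ℝ) * c < ∑ i ∈ Finset.range (n + 1), F (x.1 i, y.1 i)) →
      ∑ i : Fin (n + 1), F ((g y).1 (i : ℕ), y.1 (i : ℕ)) ≤ ((n + 1 : ℕ) : ℝ) * c := fun n => by
    refine exists_continuous_selection (n + 1) (p := fun x a =>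
      (¬∃ y : Y.carrier, ∀ x : X.carrier,
        ((n + 1 : ℕ) : ℝ) * c < ∑ i ∈ Finset.range (n + 1), F (x.1 i, y.1 i)) →
      ∑ i : Fin (n + 1), F (x.1 (i : ℕ), a i) ≤ ((n + 1 : ℕ) : ℝ) * c) fun y => ?_
    by_cases hn : ∃ y : Y.carrier, ∀ x : X.carrier,
        ((n + 1 : ℕ) : ℝ) * c < ∑ i ∈ Finset.range (n + 1), F (x.1 i, y.1 i)
    · exact ⟨Classical.arbitrary _, fun h => absurd hn h⟩
    · obtain ⟨x, hx⟩ := not_forall.mp (not_exists.mp hn y)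
      refine ⟨x, fun _ => ?_⟩
      rw [Fin.sum_univ_eq_sum_range (fun i : ℕ => F (x.1 i, y.1 i))]
      exact not_lt.mp hx
  choose g hgc hg using hsel
  have hG : ∀ n, Continuous fun y => (g n y, y) := fun n => (hgc n).prodMk continuous_id
  obtain ⟨μ, hμ, hle⟩ := exists_mem_fiberMeasures_integral_le
    ((continuous_shiftPow X 1).prodMap (continuous_shiftPow Y 1)) continuous_snd
    (S := shiftMap Y) (fun _ => rfl) f hν
    -- These are the measures carried by the graphs of `g n`; they lie over `ν` but need not be
    -- invariant.
    (fun n => ν.map (hG n).measurable.aemeasurable) (fun n => by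
      rw [ProbabilityMeasure.toMeasure_map,
        Measure.map_map continuous_snd.measurable (hG n).measurable]
      exact Measure.map_id) (c := c) (hev.mono fun n hn => by
        rw [ProbabilityMeasure.toMeasure_map]
        refine (ae_map_iff (hG n).measurable.aemeasurable ?_).mpr (Eventually.of_forall fun y => ?_)
        · refine (isClosed_le (continuous_finsetSum _ fun i _ => f.continuous.comp
            (Continuous.iterate ?_ i)) continuous_const).measurableSet
          exact (continuous_shiftPow X 1).prodMap (continuous_shiftPow Y 1)
        · refine le_of_eq_of_le ?_ (hg n y hn)
          rw [Fin.sum_univ_eq_sum_range (fun i : ℕ => F ((g n y).1 i, y.1 i))]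
          exact Finset.sum_congr rfl fun i _ => apply_iterate_shiftMap hf i (g n y, y))
  exact absurd ((isLeast_psi_subshift X Y hX f ν hν).2 ⟨μ, hμ, rfl⟩) (by linarith)

/-- Over a set of full measure there are points whose sums are on average at most `ψ_f(ν)`. -/
theorem exists_sum_le_mul_psi (hX : X.carrier.Nonempty)
    (f : C(X.carrier × Y.carrier, ℝ)) {F : A × A → ℝ}
    (hf : ∀ (x : X.carrier) (y : Y.carrier), f (x, y) = F (x.1 0, y.1 0))
    {ν : ProbabilityMeasure Y.carrier} (hν : ν ∈ invariantMeasures (shiftMap Y))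
    {G : Set Y.carrier} (hG : (ν : Measure Y.carrier) Gᶜ = 0) (n : ℕ) :
    ∃ x : X.carrier, ∃ y ∈ G, ∑ i ∈ Finset.range n, F (x.1 i, y.1 i) ≤
      n * psi (Prod.map (shiftMap X) (shiftMap Y)) Prod.snd f ν := by
  have : CompactSpace X.carrier := isCompact_iff_compactSpace.mp X.isClosed.isCompact
  have : CompactSpace Y.carrier := isCompact_iff_compactSpace.mp Y.isClosed.isCompact
  obtain ⟨⟨μ, ⟨hμ, hπ⟩, hpsi⟩, -⟩ := isLeast_psi_subshift X Y hX f ν hν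
  have hint : ∀ i : ℕ, Integrable
      (fun z => f ((Prod.map (shiftMap X) (shiftMap Y))^[i] z)) (μ : Measure _) := fun i =>
    (BoundedContinuousFunction.mkOfCompact (f.comp ⟨_, Continuous.iterate
      ((continuous_shiftPow X 1).prodMap (continuous_shiftPow Y 1)) i⟩)).integrable _
  have hval : ∫ z, ∑ i ∈ Finset.range n, f ((Prod.map (shiftMap X) (shiftMap Y))^[i] z)
      ∂(μ : Measure (X.carrier × Y.carrier)) =
      n * psi (Prod.map (shiftMap X) (shiftMap Y)) Prod.snd f ν := by
    have h : ∀ i : ℕ, ∫ z, f ((Prod.map (shiftMap X) (shiftMap Y))^[i] z)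
        ∂(μ : Measure (X.carrier × Y.carrier)) =
        psi (Prod.map (shiftMap X) (shiftMap Y)) Prod.snd f ν := fun i => by
      have hi := MeasurePreserving.iterate hμ i
      rw [← hpsi]
      dsimp only
      conv_rhs => rw [← hi.map_eq]
      rw [integral_map hi.measurable.aemeasurable f.continuous.aestronglyMeasurable]
    rw [integral_finsetSum _ fun i _ => hint i]
    simp only [h, Finset.sum_const, Finset.card_range, nsmul_eq_mul]
  have hae : ∀ᵐ z ∂(μ : Measure (X.carrier × Y.carrier)), z.2 ∈ G := by
    have h : ∀ᵐ y ∂((μ : Measure (X.carrier × Y.carrier)).map Prod.snd), y ∈ G := by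
      rw [hπ]
      exact hG
    exact ae_of_ae_map continuous_snd.measurable.aemeasurable h
  -- An integrable function is at most its integral at some point outside any given null set, here
  -- the set where `z.2 ∉ G`.
  obtain ⟨z, hz, hle⟩ := exists_notMem_null_le_integral
    (integrable_finsetSum (Finset.range n) fun i _ => hint i) hae
  refine ⟨z.1, z.2, not_not.mp hz, ?_⟩
  rw [hval] at hle
  refine le_of_eq_of_le (Finset.sum_congr rfl fun i _ => ?_) hle
  exact (apply_iterate_shiftMap hf i z).symm

end Shifts

end AdversarialOptimization

theorem mainTheorem5 {A : Type*} [Finite A] [TopologicalSpace A] [DiscreteTopology A]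
    [MeasurableSpace A] [BorelSpace A]
    (X Y : Subshift A ℤ) (hX : X.carrier.Nonempty) (hY : Y.carrier.Nonempty)
    (hXsft : IsStepSFT 1 X) (hYsft : IsStepSFT 1 Y)
    (hXtr : IsTransitive X) (hYtr : IsTransitive Y)
    (f : C(X.carrier × Y.carrier, ℝ)) (F : A × A → ℝ)
    (hf : ∀ (x : X.carrier) (y : Y.carrier), f (x, y) = F (x.1 0, y.1 0))
    (C : ℝ) (hC : 0 ≤ C)
    (ν₀ : ProbabilityMeasure Y.carrier) (hν₀ : ν₀ ∈ invariantMeasures (shiftMap Y))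
    (hsupp : (ν₀ : Measure Y.carrier) (groundStates (X := X) (Y := Y) f C)ᶜ = 0) :
    IsAlphaMaximizing (Prod.map (shiftMap X) (shiftMap Y)) (shiftMap Y) Prod.snd f ν₀ := by
  refine ⟨hν₀, fun ν hν => not_lt.mp fun hlt => ?_⟩
  obtain ⟨K, hK⟩ := exists_improvement hXtr hYtr f hf
  obtain ⟨c, hc1, hc2⟩ := exists_between hlt
  -- Beyond this length the linear gain exceeds the fixed cost `K + C`.
  obtain ⟨N, hN⟩ := exists_nat_gt ((K + C) / (c - psi (Prod.map (shiftMap X) (shiftMap Y))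
    Prod.snd f ν₀))
  obtain ⟨n, hn, w, hw⟩ := (frequently_atTop.mp
    (frequently_exists_forall_lt_sum hX f hf hν hc2)) N
  obtain ⟨x, y, hy, hxy⟩ := exists_sum_le_mul_psi hX f hf hν₀ hsupp (n + 1)
  refine hK C (n + 1) x y w (fun u => ?_) hy
  have h1 := (div_lt_iff₀ (sub_pos.mpr hc1)).mp hN
  have h2 : (N : ℝ) ≤ ((n + 1 : ℕ) : ℝ) := by exact_mod_cast hn.trans (Nat.le_succ n)
  have h3 := mul_le_mul_of_nonneg_right h2 (sub_pos.mpr hc1).le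
  rw [mul_sub (((n + 1 : ℕ) : ℝ))] at h3
  linarith [hw u]
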